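/- A quantum switch with $M$ memory registers serves $N$ users and $R$ entanglement requests in slotted time. Request $i$ concerns a nonempty set $\mathcal G(i)$ of users. User $j$ establishes its link with probability $p_j\in(0,1]$, and the switch entangles $\lambda$ users with probability $q_\lambda\in(0,1]$, all independently. Hence an activation of request $i$ succeeds with probability $r_i=q_{|\mathcal G(i)|}\prod_{j\in\mathcal G(i)}p_j$. Replace the per-slot memory constraint by the time-average constraint $\limsup_T \frac1T\sum_{t\le T}\sum_i|\mathcal G(i)|\,\mathbb E[u_i(t)]\le M$ and relax it with a Lagrange multiplier $\tau\ge 0$. The problem of minimizing the average age then separates into one Markov decision process per request $i$: - The state is the age $s\in\{1,2,\dots\}$. - Under the passive action ($u=0$), $s\to s+1$ at cost $s$. - Under the active action ($u=1$), $s\to 1$ with probability $r_i$ and $s\to s+1$ with probability $1-r_i$, at cost $s+\tau|\mathcal G(i)|$. - The objective is to minimize the average cost $\limsup_{T}\frac1T\sum_{t=1}^T\mathbb E\big[h_i(t)+\tau|\mathcal G(i)|u_i(t)\big]$ over all causal (history-dependent, randomized) policies, where $h_i(t)$ is the age at time $t$. Say that the passive action is optimal in state $s$ at multiplier $\tau$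 if there are a number $g$, a function $h:\{1,2,\dots\}\to\mathbb R$ bounded below, and a stationary deterministic policy $f$ with $f(s)=0$, such that: 1. $f$ has minimal average cost among all causal policies, from every initial age, and this cost is $g$; 2. for all states $x$, $$g+h(x)=\min\big\{x+h(x+1),\;x+\tau|\mathcal G(i)|+r_ih(1)+(1-r_i)h(x+1)\big\},$$ and the action $f(x)$ attains the minimum (the first term is the passive action). Let $\mathcal P_i(\tau)$ be the set of states in which the passive action is optimal. **Theorem.** The relaxed scheduling problem is indexable. That is, for every request $i$: if $0\le\tau_2\le\tau_1$, then $\mathcal P_i(\tau_2)\subseteq\mathcal P_i(\tau_1)$; and $\mathcal P_i(\tau)$ tends to the whole state space as $\tau\to\infty$, meaning that every state $s$ lies in $\mathcal P_i(\tau)$ for all sufficiently large $\tau$. -/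

import Mathlib

open scoped ENNReal NNReal BigOperators
open Filter

noncomputable section

/-- A quantum switch with `N` users and `M` memory registers that serves `R` entanglement requests.
Request `i` asks for entanglement among the users in `group i`; user `j` establishes a link with
probability `p j`, and the switch entangles `l` users with probability `q l`. -/
structure QuantumSwitch where
  N : ℕ
  M : ℕ
  R : ℕ
  group : Fin R → Finset (Fin N)
  group_nonempty : ∀ i, (group i).Nonempty
  p : Fin N → ℝ
  p_pos : ∀ j, 0 < p j
  p_le_one : ∀ j, p j ≤ 1
  q : ℕ → ℝ
  q_pos : ∀ i, 0 < q (group i).card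
  q_le_one : ∀ i, q (group i).card ≤ 1

/-- A causal (history-dependent, randomized) scheduling policy for one request: from the list of
past (age, action) pairs, most recent first, and the current age, it draws the current action
(`true` is active, `false` is passive). -/
abbrev CausalPolicy : Type := List (ℕ+ × Bool) → ℕ+ → PMF Bool

/-- The stationary deterministic policy given by a decision rule on ages. -/
def stationaryPolicy (f : ℕ+ → Bool) : CausalPolicy := fun _ s => PMF.pure (f s)

namespace QuantumSwitch

variable (Q : QuantumSwitch)

/-- Number of memory registers needed by request `i`. -/
def card (i : Fin Q.R) : ℕ := (Q.group i).card

/-- Probability that all users of request `i` establish their links. -/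
def v (i : Fin Q.R) : ℝ := ∏ j ∈ Q.group i, Q.p j

/-- Probability that an activation of request `i` succeeds. -/
def successProb (i : Fin Q.R) : ℝ := Q.q (Q.card i) * Q.v i

theorem successProb_pos (i : Fin Q.R) : 0 < Q.successProb i :=
  mul_pos (Q.q_pos i) (Finset.prod_pos fun j _ => Q.p_pos j)

theorem successProb_le_one (i : Fin Q.R) : Q.successProb i ≤ 1 :=
  mul_le_one₀ (Q.q_le_one i) (Finset.prod_nonneg fun j _ => (Q.p_pos j).le)
    (Finset.prod_le_one (fun j _ => (Q.p_pos j).le) fun j _ => Q.p_le_one j)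

/-- Law of the outcome of an activation of request `i` (`true` is success). -/
def outcome (i : Fin Q.R) : PMF Bool :=
  PMF.ofFintype
    (fun d => ENNReal.ofReal (if d then Q.successProb i else 1 - Q.successProb i)) (by
      rw [Fintype.sum_bool, ← ENNReal.ofReal_add]
      · simp
      · simpa using (Q.successProb_pos i).le
      · simpa using Q.successProb_le_one i)

/-- Law of the next age of request `i`, given its current age and action. -/
def step (i : Fin Q.R) (s : ℕ+) (a : Bool) : PMF ℕ+ :=
  if a then (Q.outcome i).map fun d => if d then 1 else s + 1 else PMF.pure (s + 1)

/-- Cost of one slot at age `s` under action `a`. -/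
def stageCost (i : Fin Q.R) (τ : ℝ) (s : ℕ+) (a : Bool) : ℝ :=
  (s : ℝ) + if a then τ * (Q.card i : ℝ) else 0

/-- Joint law of the past and the current age after `n` slots, under the policy `π`, when the
process starts at age `s₀`. -/
def historyLaw (i : Fin Q.R) (π : CausalPolicy) (s₀ : ℕ+) : ℕ → PMF (List (ℕ+ × Bool) × ℕ+)
  | 0 => PMF.pure ([], s₀)
  | n + 1 => (historyLaw i π s₀ n).bind fun x =>
      (π x.1 x.2).bind fun a => (Q.step i x.2 a).map fun s' => ((x.2, a) :: x.1, s')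

/-- Expected cost of the slot that follows the first `n` slots. -/
def expectedCost (i : Fin Q.R) (τ : ℝ) (π : CausalPolicy) (s₀ : ℕ+) (n : ℕ) : ℝ≥0∞ :=
  ∑' x : List (ℕ+ × Bool) × ℕ+, Q.historyLaw i π s₀ n x *
    ∑ a : Bool, π x.1 x.2 a * ENNReal.ofReal (Q.stageCost i τ x.2 a)

/-- Long-run average cost of a causal policy. -/
def averageCost (i : Fin Q.R) (τ : ℝ) (π : CausalPolicy) (s₀ : ℕ+) : ℝ≥0∞ :=
  limsup (fun T : ℕ => (∑ n ∈ Finset.range T, Q.expectedCost i τ π s₀ n) / (T : ℝ≥0∞)) atTop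

/-- Expected cost of one slot plus the expected relative value of the next age. -/
def actionValue (i : Fin Q.R) (τ : ℝ) (h : ℕ+ → ℝ) (s : ℕ+) (a : Bool) : ℝ :=
  Q.stageCost i τ s a +
    if a then Q.successProb i * h 1 + (1 - Q.successProb i) * h (s + 1) else h (s + 1)

/-- `f` is an average-cost optimal decision rule for request `i` at activation price `τ`, with
optimal average cost `g` and relative value function `h`: `f` is optimal among all causal
policies from every initial age, its average cost is `g`, and `f` attains the minimum in the
average-cost optimality equation, which `(g, h)` solves. -/
structure IsCanonicalTriplet (i : Fin Q.R) (τ : ℝ) (g : ℝ≥0) (h : ℕ+ → ℝ) (f : ℕ+ → Bool) :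
    Prop where
  optimal : ∀ (s₀ : ℕ+) (π : CausalPolicy),
    Q.averageCost i τ (stationaryPolicy f) s₀ ≤ Q.averageCost i τ π s₀
  cost_eq : ∀ s₀ : ℕ+, Q.averageCost i τ (stationaryPolicy f) s₀ = (g : ℝ≥0∞)
  bddBelow : BddBelow (Set.range h)
  optimality_eq : ∀ s : ℕ+,
    (g : ℝ) + h s = min (Q.actionValue i τ h s false) (Q.actionValue i τ h s true)
  attains : ∀ s : ℕ+, Q.actionValue i τ h s (f s) = (g : ℝ) + h s

/-- The set of ages of request `i` for which the passive action is optimal. -/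
def passiveSet (i : Fin Q.R) (τ : ℝ) : Set ℕ+ :=
  {s | ∃ (g : ℝ≥0) (h : ℕ+ → ℝ) (f : ℕ+ → Bool), Q.IsCanonicalTriplet i τ g h f ∧ f s = false}

/-- The limit of the passive sets as the activation price tends to infinity. -/
def passiveSetAtInfinity (i : Fin Q.R) : Set ℕ+ :=
  {s | ∀ᶠ τ : ℝ in atTop, s ∈ Q.passiveSet i τ}

/-- Indexability of the sub-problem of request `i`. -/
def SubproblemIndexable (i : Fin Q.R) : Prop :=
  (∀ τ₁ τ₂ : ℝ, 0 ≤ τ₂ → τ₂ ≤ τ₁ → Q.passiveSet i τ₂ ⊆ Q.passiveSet i τ₁) ∧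
    Q.passiveSetAtInfinity i = Set.univ

/-- Indexability of the relaxed scheduling problem: every sub-problem is indexable. -/
def Indexable : Prop := ∀ i : Fin Q.R, Q.SubproblemIndexable i

end QuantumSwitch

end

/-! Fix a request and write `r` for its success probability, `c = τ * card` for its activation cost.
With `h 1 = 0`, passivity attains the minimum at `s` iff `r * h (s + 1) ≤ c`. Choose `m` with
`criticalCost r m ≤ c < criticalCost r (m + 1)`; the policy active exactly above `m` then has an
explicit cost and relative value solving the optimality equation (`exists_threshold_triplet`). Since
this value is nonnegative and grows linearly, telescoping proves optimality among all causal
policies (`isCanonicalTriplet_of_optimality_eq`).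

The passive set quantifies over every canonical triplet, so the others must be controlled too. The
cost `g` is unique; for `r < 1` so is `h` up to a constant, and for `r = 1` boundedness below
replaces uniqueness. Hence `s` is passive iff `criticalCost r s ≤ c` (`mem_passiveSet_iff`), a
condition from which both claims of indexability follow at once. -/

/-! ### Expectations under a probability mass function -/

theorem PMF.tsum_bind_mul {α β : Type*} (p : PMF α) (k : α → PMF β) (F : β → ℝ≥0∞) :
    ∑' y, p.bind k y * F y = ∑' x, p x * ∑' y, k x y * F y := by
  simp only [PMF.bind_apply, ← ENNReal.tsum_mul_right, ← ENNReal.tsum_mul_left]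
  rw [ENNReal.tsum_comm]
  simp only [mul_assoc]

theorem PMF.tsum_pure_mul {α : Type*} (a : α) (F : α → ℝ≥0∞) :
    ∑' y, PMF.pure a y * F y = F a := by
  rw [tsum_eq_single a]
  · simp
  · intro b hb
    simp [PMF.pure_apply, hb]

theorem PMF.tsum_map_mul {α β : Type*} (p : PMF α) (k : α → β) (F : β → ℝ≥0∞) :
    ∑' y, p.map k y * F y = ∑' x, p x * F (k x) := by
  rw [PMF.map, PMF.tsum_bind_mul]
  simp only [Function.comp, PMF.tsum_pure_mul]

theorem PMF.tsum_mul_const {α : Type*} (p : PMF α) (a : ℝ≥0∞) : ∑' x, p x * a = a := by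
  rw [ENNReal.tsum_mul_right, p.tsum_coe, one_mul]

theorem PMF.const_add_tsum_mul {α : Type*} (p : PMF α) (a : ℝ≥0∞) (F : α → ℝ≥0∞) :
    a + ∑' x, p x * F x = ∑' x, p x * (a + F x) := by
  simp only [mul_add, ENNReal.tsum_add, p.tsum_mul_const]

/-! ### Time averages -/

/-- If partial sums of a nonnegative sequence exceed a linear function up to a multiple of the next
term and a constant, then their limiting upper average is at least the slope. -/
theorem le_limsup_average {C : ℕ → ℝ≥0∞} {g K B : ℝ≥0}
    (hC : ∀ T : ℕ, (g : ℝ≥0∞) * T ≤ ∑ n ∈ Finset.range T, C n + (K * C T + B)) :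
    (g : ℝ≥0∞) ≤ limsup (fun T : ℕ => (∑ n ∈ Finset.range T, C n) / (T : ℝ≥0∞)) atTop := by
  by_contra! hlt
  obtain ⟨a, ha, hag⟩ := exists_between hlt
  lift a to ℝ≥0 using (hag.trans ENNReal.coe_lt_top).ne
  have hev := eventually_lt_of_limsup_lt ha
  obtain ⟨T₀, hT₀⟩ := eventually_atTop.1 hev
  have hag' : (a : ℝ) < g := by exact_mod_cast hag
  have hS : ∀ T, T₀ ≤ T → 1 ≤ T → ∑ n ∈ Finset.range T, C n ≤ (a * T : ℝ≥0) := by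
    intro T h1 h2
    have := hT₀ T h1
    rw [ENNReal.div_lt_iff (Or.inl (by simp; omega)) (Or.inl (by simp))] at this
    push_cast
    exact this.le
  have hfin : ∀ n, C n ≠ ∞ := by
    intro n
    have h1 := hS (T₀ + n + 1) (by omega) (by omega)
    have h2 : C n ≤ ∑ k ∈ Finset.range (T₀ + n + 1), C k :=
      Finset.single_le_sum (f := C) (fun _ _ => zero_le) (Finset.mem_range.2 (by omega))
    exact (h2.trans h1 |>.trans_lt ENNReal.coe_lt_top).ne
  lift C to ℕ → ℝ≥0 using hfin
  have hC' : ∀ T : ℕ, (g : ℝ) * T ≤ ∑ n ∈ Finset.range T, (C n : ℝ) + (K * C T + B) := by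
    intro T
    have h1 := hC T
    beta_reduce at h1
    exact_mod_cast h1
  have hS' : ∀ T, T₀ ≤ T → 1 ≤ T → ∑ n ∈ Finset.range T, (C n : ℝ) ≤ a * T := by
    intro T h1 h2
    have h3 := hS T h1 h2
    beta_reduce at h3
    exact_mod_cast h3
  -- If the averages stay below `a < g`, the deficit `d * T` must be paid by `K * C T`, so the terms
  -- themselves grow linearly and their sums outgrow `a * T`.
  set d : ℝ := g - a with hd
  have hd0 : 0 < d := sub_pos.2 hag'
  have hK0 : (0 : ℝ) ≤ K := K.2
  have hlin : ∀ T, T₀ + 1 ≤ T → d * T - B ≤ K * (C T : ℝ) := by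
    intro T hT
    have h1 := hC' T
    have h2 := hS' T (by omega) (by omega)
    rw [hd]
    linarith
  have hgrow : ∀ A : ℝ, ∃ T₁ : ℕ, ∀ T, T₁ ≤ T → A ≤ K * (C T : ℝ) := by
    intro A
    obtain ⟨N, hN⟩ := exists_nat_ge ((A + B) / d)
    refine ⟨max N (T₀ + 1), fun T hT => ?_⟩
    have h1 := hlin T (le_trans (le_max_right _ _) hT)
    have h2 : (N : ℝ) ≤ T := by exact_mod_cast le_trans (le_max_left _ _) hT
    have h3 : A + B ≤ d * T := by
      rw [div_le_iff₀ hd0] at hN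
      nlinarith
    linarith
  obtain ⟨T₁, hT₁⟩ := hgrow (K * a + 1)
  have hsum : ∀ k : ℕ, (K * a + 1) * (k : ℝ) ≤ K * ∑ n ∈ Finset.range (T₁ + k), (C n : ℝ) := by
    intro k
    induction k with
    | zero =>
      have : 0 ≤ K * ∑ n ∈ Finset.range T₁, (C n : ℝ) :=
        mul_nonneg hK0 (Finset.sum_nonneg fun n _ => (C n).2)
      simpa using this
    | succ k ih =>
      have := hT₁ (T₁ + k) (by omega)
      rw [← add_assoc, Finset.sum_range_succ]
      push_cast
      linarith
  -- Slope `K * a + 1` against `K * a`: `k` must beat the offset `K * a * T₁`, and the added `T₀`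
  -- keeps `T₁ + k` in the range of `hS'`.
  obtain ⟨k, hk⟩ := exists_nat_ge ((K : ℝ) * a * T₁ + T₀ + 1)
  have hk0 : T₀ + 1 ≤ k := by
    have : (0 : ℝ) ≤ (K : ℝ) * a * T₁ := by positivity
    have : (T₀ : ℝ) + 1 ≤ k := by linarith
    exact_mod_cast this
  have h1 := hsum k
  have h2 := mul_le_mul_of_nonneg_left (hS' (T₁ + k) (by omega) (by omega)) hK0
  push_cast at h2
  have : (0 : ℝ) ≤ (T₀ : ℝ) := by positivity
  linarith

theorem limsup_average_le {S : ℕ → ℝ≥0∞} {g B : ℝ≥0}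
    (hS : ∀ T : ℕ, S T ≤ (g : ℝ≥0∞) * T + B) :
    limsup (fun T : ℕ => S T / (T : ℝ≥0∞)) atTop ≤ g := by
  have hlim : Tendsto (fun T : ℕ => (g : ℝ≥0∞) + B / (T : ℝ≥0∞)) atTop (nhds g) := by
    simpa using tendsto_const_nhds.add
      (ENNReal.Tendsto.const_div ENNReal.tendsto_nat_nhds_top (Or.inr ENNReal.coe_ne_top))
  rw [← hlim.limsup_eq]
  refine limsup_le_limsup ?_
  filter_upwards [eventually_ge_atTop 1] with T hT
  have hT0 : (T : ℝ≥0∞) ≠ 0 := by simp; omega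
  calc S T / T ≤ ((g : ℝ≥0∞) * T + B) / T := ENNReal.div_le_div_right (hS T) _
    _ = g + B / T := by
      rw [ENNReal.add_div, ENNReal.mul_div_cancel_right hT0 (ENNReal.natCast_ne_top T)]

noncomputable section

/-! ### The threshold solution of the optimality equation -/

/-- The activation cost at which the passive and the active action are equally good at age `x`, when
an activation succeeds with probability `r`. -/
def criticalCost (r x : ℝ) : ℝ := r * x * (x - 1) / 2 + x

/-- The unit gap, harmless for integer ages, gives `y + x - 1 ≥ 0`. -/
theorem criticalCost_mono {r x y : ℝ} (hr : 0 < r) (hx : 0 ≤ x) (hxy : x + 1 ≤ y) :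
    criticalCost r x ≤ criticalCost r y := by
  unfold criticalCost
  have : 0 ≤ (y - x) * (y + x - 1) := mul_nonneg (by linarith) (by linarith)
  nlinarith [mul_nonneg hr.le this]

theorem criticalCost_natCast_mono {r : ℝ} (hr : 0 < r) {a b : ℕ} (hab : a ≤ b) :
    criticalCost r a ≤ criticalCost r b := by
  rcases hab.eq_or_lt with rfl | hlt
  · rfl
  · exact criticalCost_mono hr (by positivity) (by exact_mod_cast hlt)

theorem natCast_le_criticalCost {r : ℝ} (hr : 0 < r) (n : ℕ) : (n : ℝ) ≤ criticalCost r n := by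
  unfold criticalCost
  rcases Nat.eq_zero_or_pos n with rfl | hn
  · simp
  · have : (1 : ℝ) ≤ n := by exact_mod_cast hn
    have : 0 ≤ r * n * (n - 1) := mul_nonneg (by positivity) (by linarith)
    linarith

theorem exists_threshold {r c : ℝ} (hr : 0 < r) (hc : 0 ≤ c) :
    ∃ m : ℕ, criticalCost r m ≤ c ∧ c < criticalCost r (m + 1) := by
  have hex : ∃ n : ℕ, c < criticalCost r (n + 1) := by
    obtain ⟨n, hn⟩ := exists_nat_ge c
    refine ⟨n, ?_⟩
    have := natCast_le_criticalCost hr (n + 1)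
    push_cast at this
    linarith
  classical
  refine ⟨Nat.find hex, ?_, Nat.find_spec hex⟩
  rcases hm : Nat.find hex with _ | k
  · simpa [criticalCost] using hc
  · have := Nat.find_min hex (m := k) (by omega)
    push_cast
    exact not_lt.1 this

/-- Average cost of activating exactly at the ages above `m`, at activation cost `c`. -/
def thresholdCost (r c m : ℝ) : ℝ :=
  (m * (m + 1) / 2 + m * r⁻¹ + r⁻¹ ^ 2 + c * r⁻¹) / (m + r⁻¹)

/-- Relative value function of the policy that activates exactly at the ages above `m`. -/
def thresholdValue (r c m x : ℝ) : ℝ :=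
  if x ≤ m + 1 then (x - 1) * thresholdCost r c m - x * (x - 1) / 2
  else r⁻¹ * x + r⁻¹ * (c - thresholdCost r c m + r⁻¹ - 1)

section Threshold

variable {r c m x : ℝ}

/-- Renewal-reward: a cycle passes through `m` passive ages and then a geometric number of
activations with mean `r⁻¹`; the right side is the expected cost of a cycle, `m + r⁻¹` its expected
length. -/
theorem thresholdCost_mul (hr : 0 < r) (hm : 0 ≤ m) :
    thresholdCost r c m * (m + r⁻¹) = m * (m + 1) / 2 + m * r⁻¹ + r⁻¹ ^ 2 + c * r⁻¹ :=
  div_mul_cancel₀ _ (by positivity)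

/-- After clearing denominators, the conclusion is the hypothesis `hc` multiplied by `r⁻¹`. -/
theorem le_thresholdCost (hr : 0 < r) (hm : 0 ≤ m) (hc : criticalCost r m ≤ c) :
    m + r⁻¹ ≤ thresholdCost r c m := by
  have hk : 0 < r⁻¹ := inv_pos.2 hr
  have hrk : r * r⁻¹ = 1 := mul_inv_cancel₀ hr.ne'
  rw [thresholdCost, le_div_iff₀ (by positivity)]
  unfold criticalCost at hc
  have h := mul_le_mul_of_nonneg_right hc hk.le
  have : (r * m * (m - 1) / 2 + m) * r⁻¹ = m * (m - 1) / 2 + m * r⁻¹ := by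
    linear_combination (m * (m - 1) / 2) * hrk
  rw [this] at h
  nlinarith

theorem thresholdCost_lt (hr : 0 < r) (hm : 0 ≤ m) (hc : c < criticalCost r (m + 1)) :
    thresholdCost r c m < m + r⁻¹ + 1 := by
  have hk : 0 < r⁻¹ := inv_pos.2 hr
  have hrk : r * r⁻¹ = 1 := mul_inv_cancel₀ hr.ne'
  rw [thresholdCost, div_lt_iff₀ (by positivity)]
  unfold criticalCost at hc
  have h := mul_lt_mul_of_pos_right hc hk
  have : (r * (m + 1) * (m + 1 - 1) / 2 + (m + 1)) * r⁻¹ = m * (m + 1) / 2 + (m + 1) * r⁻¹ := by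
    linear_combination (m * (m + 1) / 2) * hrk
  rw [this] at h
  nlinarith

theorem thresholdValue_of_le (hx : x ≤ m + 1) :
    thresholdValue r c m x = (x - 1) * thresholdCost r c m - x * (x - 1) / 2 :=
  if_pos hx

/-- The two branches agree at `m + 1` precisely because the threshold cost is the cycle ratio. -/
theorem thresholdValue_of_ge (hr : 0 < r) (hm : 0 ≤ m) (hx : m + 1 ≤ x) :
    thresholdValue r c m x = r⁻¹ * x + r⁻¹ * (c - thresholdCost r c m + r⁻¹ - 1) := by
  rcases hx.eq_or_lt with rfl | hlt
  · rw [thresholdValue_of_le le_rfl]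
    linear_combination thresholdCost_mul (c := c) hr hm
  · exact if_neg (not_le.2 hlt)

theorem thresholdValue_one (hm : 0 ≤ m) : thresholdValue r c m 1 = 0 := by
  rw [thresholdValue_of_le (by linarith)]
  ring

theorem thresholdValue_passive (hx : x ≤ m) :
    thresholdCost r c m + thresholdValue r c m x = x + thresholdValue r c m (x + 1) := by
  rw [thresholdValue_of_le (by linarith), thresholdValue_of_le (by linarith)]
  ring

theorem thresholdValue_active (hr : 0 < r) (hm : 0 ≤ m) (hx : m + 1 ≤ x) :
    thresholdCost r c m + thresholdValue r c m x
      = x + c + (1 - r) * thresholdValue r c m (x + 1) := by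
  have hrk : r * r⁻¹ = 1 := mul_inv_cancel₀ hr.ne'
  rw [thresholdValue_of_ge hr hm hx, thresholdValue_of_ge hr hm (by linarith)]
  linear_combination (x + c - thresholdCost r c m + r⁻¹) * hrk

/-- The value increases up to `m + 1`, as each passive step adds `g - x ≥ 0`; so only `x = m`
matters, where the claim is `m + r⁻¹ ≤ g`. -/
theorem mul_thresholdValue_le (hr : 0 < r) (hr1 : r ≤ 1) (hm : 0 ≤ m) (hc : criticalCost r m ≤ c)
    (hx : x ≤ m) : r * thresholdValue r c m (x + 1) ≤ c := by
  have hg := le_thresholdCost hr hm hc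
  have hrk : r * r⁻¹ = 1 := mul_inv_cancel₀ hr.ne'
  have hk1 : 1 ≤ r⁻¹ := (one_le_inv₀ hr).2 hr1
  have htop : r * thresholdValue r c m (m + 1) ≤ c := by
    rw [thresholdValue_of_ge hr hm le_rfl]
    have : r * (r⁻¹ * (m + 1) + r⁻¹ * (c - thresholdCost r c m + r⁻¹ - 1))
        = m + c - thresholdCost r c m + r⁻¹ := by
      linear_combination (m + c - thresholdCost r c m + r⁻¹) * hrk
    linarith
  refine le_trans (mul_le_mul_of_nonneg_left ?_ hr.le) htop
  rw [thresholdValue_of_le (by linarith), thresholdValue_of_le le_rfl]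
  nlinarith [mul_nonneg (sub_nonneg.2 hx) 
    (by linarith : 0 ≤ thresholdCost r c m - (m + x + 1) / 2)]

theorem lt_mul_thresholdValue (hr : 0 < r) (hm : 0 ≤ m) (hc : c < criticalCost r (m + 1))
    (hx : m + 1 ≤ x) : c < r * thresholdValue r c m (x + 1) := by
  have hg := thresholdCost_lt hr hm hc
  have hrk : r * r⁻¹ = 1 := mul_inv_cancel₀ hr.ne'
  rw [thresholdValue_of_ge hr hm (by linarith)]
  have : r * (r⁻¹ * (x + 1) + r⁻¹ * (c - thresholdCost r c m + r⁻¹ - 1))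
      = x + c - thresholdCost r c m + r⁻¹ := by
    linear_combination (x + c - thresholdCost r c m + r⁻¹) * hrk
  linarith

theorem thresholdValue_nonneg (hr : 0 < r) (hr1 : r ≤ 1) (hm : 0 ≤ m) (hc : criticalCost r m ≤ c)
    (hx : 1 ≤ x) : 0 ≤ thresholdValue r c m x := by
  have hg := le_thresholdCost hr hm hc
  have hk : 0 < r⁻¹ := inv_pos.2 hr
  have hk1 : 1 ≤ r⁻¹ := (one_le_inv₀ hr).2 hr1
  have hsmall : ∀ y, 1 ≤ y → y ≤ m + 1 → 0 ≤ thresholdValue r c m y := by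
    intro y h1 h2
    rw [thresholdValue_of_le h2]
    nlinarith [mul_nonneg (sub_nonneg.2 h1) (by linarith : 0 ≤ thresholdCost r c m - y / 2)]
  rcases le_total x (m + 1) with h | h
  · exact hsmall x hx h
  · have h0 := hsmall (m + 1) (by linarith) le_rfl
    rw [thresholdValue_of_ge hr hm le_rfl] at h0
    rw [thresholdValue_of_ge hr hm h]
    nlinarith

theorem thresholdValue_le (hr : 0 < r) (hr1 : r ≤ 1) (hm : 0 ≤ m)
    (hc : criticalCost r m ≤ c) (hx : 1 ≤ x) : thresholdValue r c m x ≤ r⁻¹ * x + r⁻¹ * (c + r⁻¹) := by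
  have hg := le_thresholdCost hr hm hc
  have hk : 0 < r⁻¹ := inv_pos.2 hr
  rcases le_total x (m + 1) with h | h
  · have h1 := mul_thresholdValue_le hr hr1 hm hc (x := x - 1) (by linarith)
    rw [sub_add_cancel] at h1
    have h2 : thresholdValue r c m x ≤ r⁻¹ * c := by
      rw [inv_mul_eq_div, le_div_iff₀ hr]
      linarith
    nlinarith [mul_pos hk hk, mul_pos hk (by linarith : 0 < x)]
  · rw [thresholdValue_of_ge hr hm h]
    nlinarith [mul_nonneg hk.le (by linarith : 0 ≤ thresholdCost r c m)]

end Threshold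

namespace QuantumSwitch

variable (Q : QuantumSwitch) (i : Fin Q.R)

/-! ### Verification of optimality -/

/-- Expected value of `ofReal ∘ h` at the age reached after `n` slots. -/
def expectedValue (h : ℕ+ → ℝ) (π : CausalPolicy) (s₀ : ℕ+) (n : ℕ) : ℝ≥0∞ :=
  ∑' x : List (ℕ+ × Bool) × ℕ+, Q.historyLaw i π s₀ n x * ENNReal.ofReal (h x.2)

theorem expectedValue_zero (h : ℕ+ → ℝ) (π : CausalPolicy) (s₀ : ℕ+) :
    Q.expectedValue i h π s₀ 0 = ENNReal.ofReal (h s₀) := by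
  rw [expectedValue, historyLaw, PMF.tsum_pure_mul]

theorem expectedValue_succ (h : ℕ+ → ℝ) (π : CausalPolicy) (s₀ : ℕ+) (n : ℕ) :
    Q.expectedValue i h π s₀ (n + 1) = ∑' x : List (ℕ+ × Bool) × ℕ+, Q.historyLaw i π s₀ n x *
      ∑ a : Bool, π x.1 x.2 a * ∑' s', Q.step i x.2 a s' * ENNReal.ofReal (h s') := by
  simp only [expectedValue, historyLaw, PMF.tsum_bind_mul, PMF.tsum_map_mul, tsum_fintype]

theorem tsum_step_mul {h : ℕ+ → ℝ} (h0 : ∀ s, 0 ≤ h s) (s : ℕ+) (a : Bool) :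
    ∑' s', Q.step i s a s' * ENNReal.ofReal (h s') = ENNReal.ofReal
      (if a then Q.successProb i * h 1 + (1 - Q.successProb i) * h (s + 1) else h (s + 1)) := by
  have hr0 := (Q.successProb_pos i).le
  have hr1 := sub_nonneg.2 (Q.successProb_le_one i)
  cases a
  · simp [step]
  · simp only [step, if_true, PMF.tsum_map_mul, tsum_fintype, Fintype.sum_bool, outcome,
      PMF.ofFintype_apply, Bool.false_eq_true, if_false]
    rw [← ENNReal.ofReal_mul hr0, ← ENNReal.ofReal_mul hr1, ← ENNReal.ofReal_add
      (mul_nonneg hr0 (h0 _)) (mul_nonneg hr1 (h0 _))]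

theorem stageCost_ge {τ : ℝ} (hτ : 0 ≤ τ) (s : ℕ+) (a : Bool) :
    (s : ℝ) ≤ Q.stageCost i τ s a := by
  unfold stageCost
  have : 0 ≤ τ * (Q.card i : ℝ) := by positivity
  split_ifs <;> linarith

theorem ofReal_stageCost_add {h : ℕ+ → ℝ} (h0 : ∀ s, 0 ≤ h s) {τ : ℝ} (hτ : 0 ≤ τ) (s : ℕ+)
    (a : Bool) :
    ENNReal.ofReal (Q.stageCost i τ s a) + ∑' s', Q.step i s a s' * ENNReal.ofReal (h s')
      = ENNReal.ofReal (Q.actionValue i τ h s a) := by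
  have hr0 := (Q.successProb_pos i).le
  have hr1 := sub_nonneg.2 (Q.successProb_le_one i)
  rw [Q.tsum_step_mul i h0, actionValue, ENNReal.ofReal_add]
  · exact le_trans (by positivity) (Q.stageCost_ge i hτ s a)
  · split_ifs
    · exact add_nonneg (mul_nonneg hr0 (h0 _)) (mul_nonneg hr1 (h0 _))
    · exact h0 _

theorem expectedCost_add_expectedValue {h : ℕ+ → ℝ} (h0 : ∀ s, 0 ≤ h s) {τ : ℝ} (hτ : 0 ≤ τ)
    (π : CausalPolicy) (s₀ : ℕ+) (n : ℕ) :
    Q.expectedCost i τ π s₀ n + Q.expectedValue i h π s₀ (n + 1)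
      = ∑' x : List (ℕ+ × Bool) × ℕ+, Q.historyLaw i π s₀ n x *
        ∑ a : Bool, π x.1 x.2 a * ENNReal.ofReal (Q.actionValue i τ h x.2 a) := by
  rw [expectedValue_succ, expectedCost, ← ENNReal.tsum_add]
  simp only [← mul_add, ← Finset.sum_add_distrib, Q.ofReal_stageCost_add i h0 hτ]

theorem le_expectedCost_add_expectedValue {h : ℕ+ → ℝ} (h0 : ∀ s, 0 ≤ h s) {τ : ℝ} (hτ : 0 ≤ τ)
    {g : ℝ≥0} (hle : ∀ s a, (g : ℝ) + h s ≤ Q.actionValue i τ h s a)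
    (π : CausalPolicy) (s₀ : ℕ+) (n : ℕ) :
    (g : ℝ≥0∞) + Q.expectedValue i h π s₀ n
      ≤ Q.expectedCost i τ π s₀ n + Q.expectedValue i h π s₀ (n + 1) := by
  rw [Q.expectedCost_add_expectedValue i h0 hτ, expectedValue, PMF.const_add_tsum_mul]
  refine ENNReal.tsum_le_tsum fun x => mul_le_mul_right ?_ _
  calc (g : ℝ≥0∞) + ENNReal.ofReal (h x.2)
      = ∑ a : Bool, π x.1 x.2 a * ENNReal.ofReal (g + h x.2) := by
        rw [ENNReal.ofReal_add g.coe_nonneg (h0 _), ENNReal.ofReal_coe_nnreal,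
          ← tsum_fintype (L := .unconditional _), PMF.tsum_mul_const]
    _ ≤ _ := Finset.sum_le_sum fun a _ =>
      mul_le_mul_right (ENNReal.ofReal_le_ofReal (hle _ _)) _

theorem expectedCost_add_expectedValue_stationary {h : ℕ+ → ℝ} (h0 : ∀ s, 0 ≤ h s) {τ : ℝ}
    (hτ : 0 ≤ τ) {g : ℝ≥0} {f : ℕ+ → Bool}
    (heq : ∀ s, Q.actionValue i τ h s (f s) = (g : ℝ) + h s) (s₀ : ℕ+) (n : ℕ) :
    Q.expectedCost i τ (stationaryPolicy f) s₀ n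
        + Q.expectedValue i h (stationaryPolicy f) s₀ (n + 1)
      = (g : ℝ≥0∞) + Q.expectedValue i h (stationaryPolicy f) s₀ n := by
  rw [Q.expectedCost_add_expectedValue i h0 hτ, expectedValue, PMF.const_add_tsum_mul]
  refine tsum_congr fun x => ?_
  rw [← tsum_fintype (L := .unconditional _), stationaryPolicy, PMF.tsum_pure_mul, heq,
    ENNReal.ofReal_add g.coe_nonneg (h0 _), ENNReal.ofReal_coe_nnreal]

/-- The age is part of the slot cost, so a value of linear growth is dominated by the cost of the
same slot. This bounds the terminal term left by telescoping, for arbitrary policies. -/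
theorem expectedValue_le {h : ℕ+ → ℝ} {τ : ℝ} (hτ : 0 ≤ τ) {K B : ℝ≥0}
    (hKB : ∀ s : ℕ+, h s ≤ K * (s : ℝ) + B) (π : CausalPolicy) (s₀ : ℕ+) (n : ℕ) :
    Q.expectedValue i h π s₀ n ≤ K * Q.expectedCost i τ π s₀ n + B := by
  rw [expectedCost, ← ENNReal.tsum_mul_left, add_comm]
  simp only [mul_left_comm (K : ℝ≥0∞)]
  rw [PMF.const_add_tsum_mul]
  refine ENNReal.tsum_le_tsum fun x => mul_le_mul_right ?_ _
  calc ENNReal.ofReal (h x.2) ≤ ENNReal.ofReal (B + K * (x.2 : ℝ)) :=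
        ENNReal.ofReal_le_ofReal (by linarith [hKB x.2])
    _ = B + K * ENNReal.ofReal (x.2 : ℝ) := by
        rw [ENNReal.ofReal_add B.coe_nonneg (by positivity), ENNReal.ofReal_mul K.coe_nonneg,
          ENNReal.ofReal_coe_nnreal, ENNReal.ofReal_coe_nnreal]
    _ = B + K * ∑ a : Bool, π x.1 x.2 a * ENNReal.ofReal (x.2 : ℝ) := by
        rw [← tsum_fintype (L := .unconditional _), PMF.tsum_mul_const]
    _ ≤ _ := by
        gcongr
        exact Q.stageCost_ge i hτ _ _

theorem le_averageCost {h : ℕ+ → ℝ} (h0 : ∀ s, 0 ≤ h s) {τ : ℝ} (hτ : 0 ≤ τ) {g K B : ℝ≥0}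
    (hle : ∀ s a, (g : ℝ) + h s ≤ Q.actionValue i τ h s a)
    (hKB : ∀ s : ℕ+, h s ≤ K * (s : ℝ) + B) (π : CausalPolicy) (s₀ : ℕ+) :
    (g : ℝ≥0∞) ≤ Q.averageCost i τ π s₀ := by
  refine le_limsup_average (K := K) (B := B) fun T => ?_
  have key : (g : ℝ≥0∞) * T ≤ ∑ n ∈ Finset.range T, Q.expectedCost i τ π s₀ n
      + Q.expectedValue i h π s₀ T := by
    induction T with
    | zero => simp
    | succ T ih =>
      rw [Finset.sum_range_succ, add_assoc]
      push_cast
      calc (g : ℝ≥0∞) * (T + 1) = g * T + g := by ring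
        _ ≤ ∑ n ∈ Finset.range T, Q.expectedCost i τ π s₀ n
            + Q.expectedValue i h π s₀ T + g := by gcongr
        _ = ∑ n ∈ Finset.range T, Q.expectedCost i τ π s₀ n
            + (g + Q.expectedValue i h π s₀ T) := by ring
        _ ≤ _ := add_le_add le_rfl (Q.le_expectedCost_add_expectedValue i h0 hτ hle π s₀ T)
  exact key.trans (by gcongr; exact Q.expectedValue_le i hτ hKB π s₀ T)

theorem averageCost_stationary_le {h : ℕ+ → ℝ} (h0 : ∀ s, 0 ≤ h s) {τ : ℝ} (hτ : 0 ≤ τ)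
    {g : ℝ≥0} {f : ℕ+ → Bool} (heq : ∀ s, Q.actionValue i τ h s (f s) = (g : ℝ) + h s)
    (s₀ : ℕ+) : Q.averageCost i τ (stationaryPolicy f) s₀ ≤ g := by
  refine limsup_average_le (B := (h s₀).toNNReal) fun T => ?_
  have key : ∑ n ∈ Finset.range T, Q.expectedCost i τ (stationaryPolicy f) s₀ n
      + Q.expectedValue i h (stationaryPolicy f) s₀ T = g * T + ENNReal.ofReal (h s₀) := by
    induction T with
    | zero => simp [expectedValue_zero]
    | succ T ih =>
      rw [Finset.sum_range_succ, add_assoc,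
        Q.expectedCost_add_expectedValue_stationary i h0 hτ heq, add_left_comm, ih]
      push_cast
      ring
  exact le_self_add.trans key.le

/-- A nonnegative solution of the optimality equation of at most linear growth, with a decision rule
that attains the minimum, is a canonical triplet. -/
theorem isCanonicalTriplet_of_optimality_eq {h : ℕ+ → ℝ} (h0 : ∀ s, 0 ≤ h s) {τ : ℝ}
    (hτ : 0 ≤ τ) {g K B : ℝ≥0} {f : ℕ+ → Bool}
    (hle : ∀ s a, (g : ℝ) + h s ≤ Q.actionValue i τ h s a)
    (heq : ∀ s, Q.actionValue i τ h s (f s) = (g : ℝ) + h s)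
    (hKB : ∀ s : ℕ+, h s ≤ K * (s : ℝ) + B) : Q.IsCanonicalTriplet i τ g h f where
  optimal s₀ π := (Q.averageCost_stationary_le i h0 hτ heq s₀).trans
    (Q.le_averageCost i h0 hτ hle hKB π s₀)
  cost_eq s₀ := (Q.averageCost_stationary_le i h0 hτ heq s₀).antisymm
    (Q.le_averageCost i h0 hτ hle hKB _ s₀)
  bddBelow := ⟨0, by rintro _ ⟨s, rfl⟩; exact h0 s⟩
  optimality_eq s := by
    refine le_antisymm (le_min (hle s _) (hle s _)) ?_
    rw [← heq s]
    cases f s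
    · exact min_le_left _ _
    · exact min_le_right _ _
  attains := heq

theorem IsCanonicalTriplet.cost_unique {Q : QuantumSwitch} {i : Fin Q.R} {τ : ℝ} {g g' : ℝ≥0}
    {h h' : ℕ+ → ℝ} {f f' : ℕ+ → Bool} (H : Q.IsCanonicalTriplet i τ g h f)
    (H' : Q.IsCanonicalTriplet i τ g' h' f') : g = g' := by
  have h1 := H.optimal 1 (stationaryPolicy f')
  have h2 := H'.optimal 1 (stationaryPolicy f)
  rw [H.cost_eq, H'.cost_eq] at h1 h2
  exact_mod_cast le_antisymm h1 h2

/-! ### The passive sets -/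

theorem exists_threshold_triplet {τ : ℝ} (hτ : 0 ≤ τ) {m : ℕ}
    (hm : criticalCost (Q.successProb i) m ≤ τ * Q.card i)
    (hm' : τ * Q.card i < criticalCost (Q.successProb i) (m + 1)) :
    ∃ g : ℝ≥0, (g : ℝ) = thresholdCost (Q.successProb i) (τ * Q.card i) m ∧
      Q.IsCanonicalTriplet i τ g
        (fun s => thresholdValue (Q.successProb i) (τ * Q.card i) m (s : ℝ))
        (fun s => decide (m < (s : ℕ))) := by
  set r := Q.successProb i with hr_def
  set c := τ * (Q.card i : ℝ) with hc_def
  have hr : 0 < r := Q.successProb_pos i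
  have hc : 0 ≤ c := by positivity
  have hm0 : (0 : ℝ) ≤ m := by positivity
  have hk : 0 < r⁻¹ := inv_pos.2 hr
  have hg : 0 ≤ thresholdCost r c m := le_trans (by positivity) (le_thresholdCost hr hm0 hm)
  have hs1 : ∀ s : ℕ+, (1 : ℝ) ≤ (s : ℝ) := fun s => by exact_mod_cast s.pos
  obtain ⟨g, hgc⟩ : ∃ g : ℝ≥0, (g : ℝ) = thresholdCost r c m := ⟨⟨_, hg⟩, rfl⟩
  refine ⟨g, hgc, Q.isCanonicalTriplet_of_optimality_eq i
    (K := ⟨r⁻¹, hk.le⟩) (B := ⟨r⁻¹ * (c + r⁻¹), by positivity⟩) ?_ hτ ?_ ?_ ?_⟩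
  · exact fun s => thresholdValue_nonneg hr (Q.successProb_le_one i) hm0 hm (hs1 s)
  · intro s a
    rcases Nat.lt_or_ge m s with h | h
    · have hx : (m : ℝ) + 1 ≤ s := by exact_mod_cast h
      have h1 := thresholdValue_active (c := c) hr hm0 hx
      have h2 := lt_mul_thresholdValue hr hm0 hm' hx
      cases a <;> simp [actionValue, stageCost, thresholdValue_one hm0, ← hr_def, ← hc_def] <;>
        linarith
    · have hx : (s : ℝ) ≤ m := by exact_mod_cast h
      have h1 := thresholdValue_passive (r := r) (c := c) hx
      have h2 := mul_thresholdValue_le hr (Q.successProb_le_one i) hm0 hm hx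
      cases a <;> simp [actionValue, stageCost, thresholdValue_one hm0, ← hr_def, ← hc_def] <;>
        linarith
  · intro s
    rcases Nat.lt_or_ge m s with h | h
    · have hx : (m : ℝ) + 1 ≤ s := by exact_mod_cast h
      have h1 := thresholdValue_active (c := c) hr hm0 hx
      simp [h, actionValue, stageCost, thresholdValue_one hm0, ← hr_def, ← hc_def]
      linarith
    · have hx : (s : ℝ) ≤ m := by exact_mod_cast h
      have h1 := thresholdValue_passive (r := r) (c := c) hx
      simp [h.not_gt, actionValue, stageCost]
      linarith
  · exact fun s => thresholdValue_le hr (Q.successProb_le_one i) hm0 hm (hs1 s)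

/-! ### Constraints on an arbitrary canonical triplet -/

variable {Q i}

theorem IsCanonicalTriplet.relativeValue_eq {τ : ℝ} {g : ℝ≥0} {h : ℕ+ → ℝ} {f : ℕ+ → Bool}
    (H : Q.IsCanonicalTriplet i τ g h f) (s : ℕ+) :
    (g : ℝ) + (h s - h 1) = s + min (h (s + 1) - h 1)
      (τ * Q.card i + (1 - Q.successProb i) * (h (s + 1) - h 1)) := by
  have := H.optimality_eq s
  simp only [actionValue, stageCost, if_true, Bool.false_eq_true, if_false] at this
  rw [← min_add_add_left]
  rw [show (g : ℝ) + (h s - h 1) = (g + h s) - h 1 by ring, this, ← min_sub_sub_right]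
  congr 1 <;> ring

/-- When activations may fail, the relative value function is unique up to a constant. -/
theorem IsCanonicalTriplet.relativeValue_unique {τ : ℝ} {g : ℝ≥0} {h h' : ℕ+ → ℝ}
    {f f' : ℕ+ → Bool} (hr : Q.successProb i < 1) (H : Q.IsCanonicalTriplet i τ g h f)
    (H' : Q.IsCanonicalTriplet i τ g h' f') (s : ℕ+) : h s - h 1 = h' s - h' 1 := by
  -- Both slopes, `1` and `1 - r`, are positive, so the optimality equation determines `h (s + 1) -
  -- h 1` from `h s - h 1`.
  have hmono : StrictMono fun t : ℝ => min t (τ * Q.card i + (1 - Q.successProb i) * t) := by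
    intro a b hab
    exact min_lt_min hab (by nlinarith)
  induction s using PNat.recOn with
  | one => simp
  | succ s ih =>
    have h1 := H.relativeValue_eq s
    have h2 := H'.relativeValue_eq s
    refine hmono.injective ?_
    linarith

theorem IsCanonicalTriplet.mul_relativeValue_le {τ : ℝ} {g : ℝ≥0} {h : ℕ+ → ℝ} {f : ℕ+ → Bool}
    (H : Q.IsCanonicalTriplet i τ g h f) {s : ℕ+} (hs : f s = false) :
    Q.successProb i * (h (s + 1) - h 1) ≤ τ * Q.card i := by
  have h1 := H.attains s
  rw [H.optimality_eq s, hs] at h1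
  have h2 := h1.le.trans (min_le_right _ _)
  simp only [actionValue, stageCost, if_true, Bool.false_eq_true, if_false] at h2
  linarith

/-- When activations always succeed, an optimal decision rule is active at every age `s` with
`g < s + 1`: otherwise the relative value function would not be bounded below. -/
theorem IsCanonicalTriplet.active_of_cost_lt {τ : ℝ} {g : ℝ≥0} {h : ℕ+ → ℝ} {f : ℕ+ → Bool}
    (hr : Q.successProb i = 1) (H : Q.IsCanonicalTriplet i τ g h f) {s : ℕ+}
    (hs : (g : ℝ) < s + 1) : f s = true := by
  by_contra hf
  have h0 := H.mul_relativeValue_le (Bool.eq_false_iff.2 hf)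
  rw [hr, one_mul] at h0
  set d : ℝ := s + 1 - g with hd
  have hd0 : 0 < d := by linarith
  -- From `s + 1` on, each passive step lowers the relative value by `t - g ≥ d`.
  have hdesc : ∀ k : ℕ, ∃ t : ℕ+, (s : ℝ) + 1 ≤ t ∧ h t - h 1 ≤ τ * Q.card i - k * d := by
    intro k
    induction k with
    | zero => exact ⟨s + 1, by simp, by simpa using h0⟩
    | succ k ih =>
      obtain ⟨t, ht, htk⟩ := ih
      refine ⟨t + 1, by push_cast; linarith, ?_⟩
      have h1 := H.relativeValue_eq t
      rw [hr, sub_self, zero_mul, add_zero] at h1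
      have hkd : 0 ≤ (k : ℝ) * d := by positivity
      -- If the minimum were the activation cost, that cost would be at most itself minus `(k + 1) *
      -- d`, which is absurd.
      rcases min_choice (h (t + 1) - h 1) (τ * Q.card i) with h2 | h2 <;> rw [h2] at h1
      · push_cast
        linarith
      · linarith
  obtain ⟨b, hb⟩ := H.bddBelow
  obtain ⟨k, hk⟩ := exists_nat_gt ((τ * Q.card i + h 1 - b) / d)
  obtain ⟨t, -, ht⟩ := hdesc k
  have := hb ⟨t, rfl⟩
  rw [div_lt_iff₀ hd0] at hk
  linarith

variable (Q i)

/-- The passive action is optimal at age `s` exactly if the activation cost is at least the critical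
cost of `s`. -/
theorem mem_passiveSet_iff {τ : ℝ} (hτ : 0 ≤ τ) (s : ℕ+) :
    s ∈ Q.passiveSet i τ ↔ criticalCost (Q.successProb i) s ≤ τ * Q.card i := by
  have hr : 0 < Q.successProb i := Q.successProb_pos i
  obtain ⟨m, hm, hm'⟩ := exists_threshold hr (c := τ * Q.card i) (by positivity)
  have hm0 : (0 : ℝ) ≤ m := by positivity
  obtain ⟨g, hg, H⟩ := Q.exists_threshold_triplet i hτ hm hm'
  constructor
  · rintro ⟨g', h, f, H', hf⟩
    obtain rfl := H.cost_unique H'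
    by_contra! hlt
    have hms : m < (s : ℕ) := by
      by_contra! hle
      exact absurd (criticalCost_natCast_mono hr hle) (by linarith)
    have hx : (m : ℝ) + 1 ≤ s := by exact_mod_cast hms
    rcases (Q.successProb_le_one i).lt_or_eq with hr1 | hr1
    · have h1 := H'.mul_relativeValue_le hf
      rw [H'.relativeValue_unique hr1 H (s + 1)] at h1
      have h2 := lt_mul_thresholdValue hr hm0 hm' hx
      simp only [PNat.add_coe, PNat.one_coe, Nat.cast_add, Nat.cast_one,
        thresholdValue_one hm0, sub_zero] at h1
      linarith
    -- With `r = 1` this reads `g < m + 2 ≤ s + 1`.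
    · have h1 := thresholdCost_lt hr hm0 hm'
      rw [← hg, hr1, inv_one] at h1
      have := H'.active_of_cost_lt hr1 (s := s) (by linarith)
      simp [hf] at this
  · intro hs
    refine ⟨g, _, _, H, ?_⟩
    simp only [decide_eq_false_iff_not, not_lt]
    by_contra! hlt
    have := criticalCost_natCast_mono hr (Nat.succ_le_of_lt hlt)
    push_cast at this
    linarith

end QuantumSwitch

end

/-- The relaxed scheduling problem of every quantum switch is indexable. -/
theorem theorem1 (Q : QuantumSwitch) : Q.Indexable := by
  intro i
  refine ⟨fun τ₁ τ₂ h0 hle s hs => ?_, Set.eq_univ_of_forall fun s => ?_⟩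
  · rw [Q.mem_passiveSet_iff i h0] at hs
    rw [Q.mem_passiveSet_iff i (h0.trans hle)]
    exact hs.trans (by gcongr)
  · have hcard : (1 : ℝ) ≤ Q.card i := by
      exact_mod_cast Finset.card_pos.2 (Q.group_nonempty i)
    change ∀ᶠ τ : ℝ in atTop, s ∈ Q.passiveSet i τ
    filter_upwards [eventually_ge_atTop 0, eventually_ge_atTop (criticalCost (Q.successProb i) s)]
      with τ hτ hτs
    rw [Q.mem_passiveSet_iff i hτ]
    nlinarith
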